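/- Let $\Sigma^*$ be the set of finite binary strings and let $|p|$ be the length of $p\in\Sigma^*$. A \emph{computer} is a partial recursive function $C\colon\Sigma^*\to\Sigma^*$ whose domain is prefix-free (no string in it is a proper prefix of another string in it). A computer $U$ is \emph{optimal} if for every computer $C$ there is a constant $\mathrm{sim}(C)$ such that whenever $C(p)$ is defined there is $p'$ with $U(p')=C(p)$ and $|p'|\le|p|+\mathrm{sim}(C)$. Fix an optimal computer $U$ and put, for $s\in\Sigma^*$, $$K(s)=\min\{|p| : U(p)=s\},\qquad P(s)=\sum_{p\,:\,U(p)=s}2^{-|p|}.$$ Let $N\ge 1$. A \emph{POVM on $\Sigma^*$} is a map $R$ from $\Sigma^*$ to the positive semi-definite Hermitian $N\times N$ complex matrices with $\sum_{s\in\Sigma^*}R(s)=I$. It is \emph{computable} if there is a total recursive function $G$ from $\Sigma^*\times\mathbb{N}$ to the $N\times N$ matrices with entries in $\mathbb{Q}+i\mathbb{Q}$ such that $\|R(s)-G(s,k)\|<2^{-k}$ in operator norm for all $s\in\Sigma^*$ and $k\in\mathbb{N}$. A \emph{density matrix} is a positive semi-definite Hermitian $N\times N$ complex matrix of trace $1$.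 Put $-\log_2 0=\infty$. \textbf{Theorem.} Let $R$ be a computable POVM on $\Sigma^*$. Then: \begin{enumerate} \item There is $d\in\mathbb{N}$ such that $K(s)-d\le-\log_2\operatorname{tr}(\rho R(s))$ for every density matrix $\rho$ and every $s\in\Sigma^*$. \item There is a real $c>0$ such that $\operatorname{tr}(\rho R(s))\le c\,P(s)$ for every density matrix $\rho$ and every $s\in\Sigma^*$. \end{enumerate} -/

import Mathlib

noncomputable section

namespace AlgPOVM

/-- Finite binary strings. -/
abbrev Str : Type := List Bool

/-! ### Computers, program-size complexity, halting probability -/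

/-- A computer: a partial recursive function on strings whose domain is prefix-free. -/
structure IsComputer (C : Str →. Str) : Prop where
  partrec : Partrec C
  prefixFree : ∀ p q : Str, (C p).Dom → (C q).Dom → p <+: q → p = q

/-- `U` is an optimal computer: it simulates every computer with a bounded overhead in the
length of programs. -/
structure IsOptimal (U : Str →. Str) : Prop where
  isComputer : IsComputer U
  simulates : ∀ C : Str →. Str, IsComputer C →
    ∃ sim : ℕ, ∀ p s : Str, s ∈ C p → ∃ p' : Str, s ∈ U p' ∧ p'.length ≤ p.length + sim

/-- The least length of a program `p` with `C p = s` (`⊤` if there is none, which does not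
happen for an optimal computer). -/
def complexity (C : Str →. Str) (s : Str) : ℕ∞ :=
  ⨅ p : {p : Str // s ∈ C p}, (p.1.length : ℕ∞)

/-- The probability `∑_{C p = s} 2^{-|p|}` that `C` outputs `s` on random input
(the series converges for every computer, by Kraft's inequality). -/
def haltingProb (C : Str →. Str) (s : Str) : ℝ :=
  ∑' p : {p : Str // s ∈ C p}, (2 : ℝ) ^ (-(p.1.length : ℤ))

/-! ### Computable matrix-valued functions -/

/-- A rational-valued function is total recursive: the positive and negative parts of the
numerator and the denominator of its value in lowest terms are. -/
structure RecursiveRat {α : Type} [Primcodable α] (f : α → ℚ) : Prop where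
  num_pos : Computable fun a => (f a).num.toNat
  num_neg : Computable fun a => (-(f a).num).toNat
  den : Computable fun a => (f a).den

/-- A function with values in the `N × N` matrices over the complex numbers `a + ib`,
`a, b` rational (written as pairs `(a, b)`), is total recursive: its entries are. -/
def RecursiveMatrix {α : Type} [Primcodable α] {N : ℕ}
    (G : α → Matrix (Fin N) (Fin N) (ℚ × ℚ)) : Prop :=
  ∀ i j, RecursiveRat (fun a => (G a i j).1) ∧ RecursiveRat (fun a => (G a i j).2)

/-- The complex number `a + ib` given by a pair of rationals. -/
def toComplex (z : ℚ × ℚ) : ℂ := ⟨(z.1 : ℝ), (z.2 : ℝ)⟩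

open scoped Matrix.Norms.L2Operator in
/-- A matrix-valued function on strings is computable: its values can be computed to within
`2^{-k}` in the operator norm (of the Euclidean norm), uniformly in the string and in `k`. -/
def IsComputable {N : ℕ} (F : Str → Matrix (Fin N) (Fin N) ℂ) : Prop :=
  ∃ G : Str × ℕ → Matrix (Fin N) (Fin N) (ℚ × ℚ), RecursiveMatrix G ∧
    ∀ (s : Str) (k : ℕ), ‖F s - (G (s, k)).map toComplex‖ < (2 : ℝ) ^ (-(k : ℤ))

/-! ### POVMs and states -/

open scoped ComplexOrder in
/-- A POVM on the set of strings: positive semi-definite Hermitian matrices with sum `I`. -/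
structure IsPOVM {N : ℕ} (R : Str → Matrix (Fin N) (Fin N) ℂ) : Prop where
  posSemidef : ∀ s, (R s).PosSemidef
  hasSum : HasSum R 1

open scoped ComplexOrder in
/-- A density matrix: positive semi-definite Hermitian with trace one. -/
structure IsDensityMatrix {N : ℕ} (ρ : Matrix (Fin N) (Fin N) ℂ) : Prop where
  posSemidef : ρ.PosSemidef
  trace_eq_one : ρ.trace = 1

/-- `tr(ρE)`, the probability of the outcome with POVM element `E` in the state `ρ`; the trace
is a real number for positive semi-definite `ρ` and `E`. -/
def outcomeProb {N : ℕ} (ρ E : Matrix (Fin N) (Fin N) ℂ) : ℝ := (ρ * E).trace.re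

/-- `-log₂ x` for `x ≥ 0`, with `-log₂ 0 = ∞`. -/
def negLogTwo (x : ℝ) : EReal := if x = 0 then ⊤ else ((-Real.logb 2 x : ℝ) : EReal)

end AlgPOVM

end

noncomputable section

namespace AlgPOVM

/-! For a density matrix `ρ`, `tr(ρR(s)) ≤ tr R(s)` (`outcomeProb_nonneg_and_le`), so both claims
reduce to the weights `r(s) = tr R(s)`, which no longer depend on the state and have total mass `tr
I = N`. It suffices to find `U`-programs `p` for `s` with `r(s) ≤ 2^d 2^{-|p|}`
(`IsOptimal.exists_program`): then `K(s) ≤ |p|` gives the first claim, and `2^{-|p|}`, a single term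
of `P(s)`, gives the second.

The weights are only approximable. Computing `r(s)` from above with error `O(2^{-encode s})` keeps
the total mass finite, and rounding to powers of two gives recursive code lengths satisfying Kraft's
inequality after a constant shift (`exists_computable_length`). A Shannon–Fano–Elias code realizes
such lengths by a computer (`exists_isComputer_length`), which `U` simulates. -/

/-! ### Kraft's inequality -/

/-- A prefix-free set of nonempty words is uniquely decodable. -/
theorem uniquelyDecodable_of_prefixFree {α : Type*} {S : Set (List α)} (h0 : [] ∉ S)
    (hS : ∀ p ∈ S, ∀ q ∈ S, p <+: q → p = q) : InformationTheory.UniquelyDecodable S := by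
  intro L₁
  induction L₁ with
  | nil =>
    rintro (_ | ⟨b, L₂⟩) _ h₂ h
    · rfl
    · have hb : b = [] := by
        have := h.symm
        simp only [List.flatten_cons, List.flatten_nil, List.append_eq_nil_iff] at this
        exact this.1
      exact absurd (hb ▸ h₂ b (by simp)) h0
  | cons a L₁ ih =>
    rintro (_ | ⟨b, L₂⟩) h₁ h₂ h
    · have ha : a = [] := by
        simp only [List.flatten_cons, List.flatten_nil, List.append_eq_nil_iff] at h
        exact h.1
      exact absurd (ha ▸ h₁ a (by simp)) h0
    · simp only [List.flatten_cons] at h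
      have haS := h₁ a (by simp)
      have hbS := h₂ b (by simp)
      have hab : a = b := by
        rcases List.prefix_or_prefix_of_prefix (List.prefix_append a L₁.flatten)
          (h ▸ List.prefix_append b L₂.flatten) with hp | hp
        · exact hS a haS b hbS hp
        · exact (hS b hbS a haS hp).symm
      subst hab
      rw [ih L₂ (fun w hw => h₁ w (by simp [hw])) (fun w hw => h₂ w (by simp [hw]))
        (List.append_cancel_left h)]

/-- Kraft's inequality for finite prefix-free sets of binary words. -/
theorem kraft_of_prefixFree (S : Finset Str) (hS : ∀ p ∈ S, ∀ q ∈ S, p <+: q → p = q) :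
    ∑ p ∈ S, (2 : ℝ) ^ (-(p.length : ℤ)) ≤ 1 := by
  -- The empty word is never part of a uniquely decodable set, so McMillan's inequality misses
  -- exactly the case `S = {[]}`.
  by_cases h0 : [] ∈ S
  · have : S = {[]} := by
      ext p
      refine ⟨fun hp => ?_, fun hp => ?_⟩
      · simpa using (hS [] h0 p hp (List.nil_prefix)).symm
      · rw [Finset.mem_singleton] at hp
        exact hp ▸ h0
    simp [this]
  · have := InformationTheory.kraft_mcmillan_inequality
      (uniquelyDecodable_of_prefixFree (S := (S : Set Str)) (by simpa using h0) (by simpa using hS))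
    simpa using this

/-- Needed because a divergent real `tsum` takes the default value 0, which would spoil lower bounds
on `haltingProb`. -/
theorem IsComputer.summable {C : Str →. Str} (hC : IsComputer C) (s : Str) :
    Summable fun p : {p : Str // s ∈ C p} => (2 : ℝ) ^ (-(p.1.length : ℤ)) := by
  refine summable_of_sum_le (c := 1) (fun p => by positivity) fun u => ?_
  have := kraft_of_prefixFree (u.map (Function.Embedding.subtype _)) (by
    intro p hp q hq hpq
    simp only [Finset.mem_map, Function.Embedding.subtype_apply] at hp hq
    obtain ⟨⟨p, hp⟩, -, rfl⟩ := hp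
    obtain ⟨⟨q, hq⟩, -, rfl⟩ := hq
    exact hC.prefixFree p q (Part.dom_iff_mem.2 ⟨_, hp⟩) (Part.dom_iff_mem.2 ⟨_, hq⟩) hpq)
  simpa using this

theorem IsComputer.two_zpow_le_haltingProb {C : Str →. Str} (hC : IsComputer C) {p s : Str}
    (hp : s ∈ C p) : (2 : ℝ) ^ (-(p.length : ℤ)) ≤ haltingProb C s :=
  (hC.summable s).le_tsum ⟨p, hp⟩ fun _ _ => by positivity

/-! ### Words as binary numerals -/

/-- The number written by a word in binary, most significant bit first. -/
def binVal (p : Str) : ℕ := p.foldl (fun v b => 2 * v + b.toNat) 0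

theorem foldl_binVal (q : Str) (v : ℕ) :
    q.foldl (fun v b => 2 * v + b.toNat) v = v * 2 ^ q.length + binVal q := by
  induction q generalizing v with
  | nil => simp [binVal]
  | cons b q ih =>
    rw [binVal, List.foldl_cons, List.foldl_cons, ih, ih (2 * 0 + b.toNat), List.length_cons]
    ring

theorem binVal_append (p q : Str) : binVal (p ++ q) = binVal p * 2 ^ q.length + binVal q := by
  rw [binVal, List.foldl_append, foldl_binVal]
  rfl

theorem binVal_lt (p : Str) : binVal p < 2 ^ p.length := by
  induction p using List.reverseRecOn with
  | nil => simp [binVal]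
  | append_singleton p b ih =>
    have hb : binVal [b] ≤ 1 := by cases b <;> simp [binVal]
    rw [binVal_append, List.length_append, pow_add]
    simp only [List.length_singleton, pow_one]
    omega

theorem exists_binVal_eq (L : ℕ) : ∀ a < 2 ^ L, ∃ p : Str, p.length = L ∧ binVal p = a := by
  induction L with
  | zero => intro a ha; exact ⟨[], rfl, by simp at ha; simp [ha, binVal]⟩
  | succ L ih =>
    intro a ha
    obtain ⟨p, hp, hv⟩ := ih (a / 2) (by rw [pow_succ] at ha; omega)
    refine ⟨p ++ [a % 2 == 1], by simp [hp], ?_⟩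
    rw [binVal_append, hv]
    rcases Nat.mod_two_eq_zero_or_one a with h | h <;> simp [binVal, h] <;> omega

theorem primrec_binVal : Primrec binVal := by
  have hb : Primrec Bool.toNat := Primrec.dom_finite _
  exact Primrec.list_foldl (h := fun (_ : Str) (x : ℕ × Bool) => 2 * x.1 + x.2.toNat) Primrec.id (Primrec.const 0)
    (Primrec.nat_add.comp
      (Primrec.nat_mul.comp (Primrec.const 2) (Primrec.fst.comp Primrec.snd))
      (hb.comp (Primrec.snd.comp Primrec.snd))).to₂

theorem primrec_nat_pow : Primrec₂ ((· ^ ·) : ℕ → ℕ → ℕ) :=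
  Primrec₂.unpaired'.1 Nat.Primrec.pow

theorem primrec_nat_log : Primrec (Nat.log 2) := by
  have : PrimrecRel fun b e : ℕ => 2 ^ e ≤ b :=
    Primrec.nat_le.comp (primrec_nat_pow.comp (Primrec.const 2) Primrec.snd) Primrec.fst
  refine (Primrec.nat_findGreatest Primrec.id this).of_eq fun b => ?_
  rw [Nat.findGreatest_eq_iff]
  refine ⟨Nat.log_le_self 2 b, fun h => ?_, fun n hn _ => ?_⟩
  · exact Nat.pow_log_le_self 2 (by rintro rfl; simp at h)
  · exact not_le.2 (Nat.lt_pow_of_log_lt one_lt_two hn)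

/-! ### A prefix code with prescribed computable lengths -/

/-- Numerator and exponent of the dyadic rational `∑ m < n, 2 ^ (-l m)`. -/
def dyadicSum (l : ℕ → ℕ) (n : ℕ) : ℕ × ℕ :=
  Nat.rec (0, 0) (fun m x => (x.1 * 2 ^ l m + 2 ^ x.2, x.2 + l m)) n

theorem dyadicSum_succ (l : ℕ → ℕ) (n : ℕ) : dyadicSum l (n + 1) =
    ((dyadicSum l n).1 * 2 ^ l n + 2 ^ (dyadicSum l n).2, (dyadicSum l n).2 + l n) := rfl

theorem dyadicSum_eq (l : ℕ → ℕ) (n : ℕ) :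
    ((dyadicSum l n).1 : ℝ) / 2 ^ (dyadicSum l n).2 = ∑ m ∈ Finset.range n, (1 / 2 : ℝ) ^ l m := by
  induction n with
  | zero => simp [dyadicSum]
  | succ n ih =>
    rw [Finset.sum_range_succ, ← ih, dyadicSum_succ]
    push_cast
    rw [pow_add, one_div, inv_pow]
    field_simp

theorem computable_dyadicSum {l : ℕ → ℕ} (hl : Computable l) : Computable (dyadicSum l) := by
  have pw : Computable₂ ((· ^ ·) : ℕ → ℕ → ℕ) := primrec_nat_pow.to_comp
  have hlm : Computable fun y : ℕ × ℕ × (ℕ × ℕ) => l y.2.1 :=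
    hl.comp (Computable.fst.comp Computable.snd)
  have h1 : Computable fun y : ℕ × ℕ × (ℕ × ℕ) => y.2.2.1 :=
    Computable.fst.comp (Computable.snd.comp Computable.snd)
  have h2 : Computable fun y : ℕ × ℕ × (ℕ × ℕ) => y.2.2.2 :=
    Computable.snd.comp (Computable.snd.comp Computable.snd)
  have add : Computable₂ ((· + ·) : ℕ → ℕ → ℕ) := Primrec.nat_add.to_comp
  have mul : Computable₂ ((· * ·) : ℕ → ℕ → ℕ) := Primrec.nat_mul.to_comp
  have two : Computable fun _ : ℕ × ℕ × (ℕ × ℕ) => 2 := Computable.const 2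
  have h3 : Computable fun y : ℕ × ℕ × (ℕ × ℕ) =>
      (y.2.2.1 * 2 ^ l y.2.1 + 2 ^ y.2.2.2, y.2.2.2 + l y.2.1) :=
    Computable.pair (add.comp (mul.comp h1 (pw.comp two hlm)) (pw.comp two h2)) (add.comp h2 hlm)
  exact Computable.nat_rec (f := fun n : ℕ => n) (g := fun _ => (0, 0))
    (h := fun _ y => (y.2.1 * 2 ^ l y.1 + 2 ^ y.2.2, y.2.2 + l y.1))
    Computable.id (Computable.const (0, 0)) h3.to₂

/-- The dyadic interval of the word `p`, of length `l n + 1`, lies in the `n`-th of the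
consecutive intervals of lengths `2 ^ (-l m)`. -/
def IsCodeword (l : ℕ → ℕ) (p : Str) (n : ℕ) : Prop :=
  p.length = l n + 1 ∧
  (dyadicSum l n).1 * 2 ^ p.length ≤ binVal p * 2 ^ (dyadicSum l n).2 ∧
  (binVal p + 1) * 2 ^ (dyadicSum l (n + 1)).2 ≤ (dyadicSum l (n + 1)).1 * 2 ^ p.length

instance (l : ℕ → ℕ) (p : Str) (n : ℕ) : Decidable (IsCodeword l p n) :=
  inferInstanceAs (Decidable (_ ∧ _ ∧ _))

theorem isCodeword_iff {l : ℕ → ℕ} {p : Str} {n : ℕ} : IsCodeword l p n ↔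
    p.length = l n + 1 ∧
    ∑ m ∈ Finset.range n, (1 / 2 : ℝ) ^ l m ≤ binVal p / 2 ^ p.length ∧
    ((binVal p : ℝ) + 1) / 2 ^ p.length ≤ ∑ m ∈ Finset.range (n + 1), (1 / 2 : ℝ) ^ l m := by
  rw [← dyadicSum_eq, ← dyadicSum_eq, div_le_div_iff₀ (by positivity) (by positivity),
    div_le_div_iff₀ (by positivity) (by positivity), IsCodeword]
  norm_cast

/-- The dyadic interval of an extension of `p` lies inside that of `p`, whereas intervals for
different indices do not overlap. The case `p = q` makes decoding unambiguous. -/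
theorem IsCodeword.index_eq_of_prefix {l : ℕ → ℕ} {p q : Str} {m n : ℕ} (hp : IsCodeword l p m)
    (hq : IsCodeword l q n) (hpq : p <+: q) : m = n := by
  obtain ⟨-, hp1, hp2⟩ := isCodeword_iff.1 hp
  obtain ⟨-, hq1, hq2⟩ := isCodeword_iff.1 hq
  obtain ⟨t, rfl⟩ := hpq
  have mono : Monotone fun n => ∑ m ∈ Finset.range n, (1 / 2 : ℝ) ^ l m :=
    fun a b hab => Finset.sum_le_sum_of_subset_of_nonneg (by simpa using hab)
      fun _ _ _ => by positivity
  have ht : (binVal t : ℝ) + 1 ≤ 2 ^ t.length := by exact_mod_cast binVal_lt t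
  have hval : (binVal (p ++ t) : ℝ) / 2 ^ (p ++ t).length =
      binVal p / 2 ^ p.length + binVal t / (2 ^ p.length * 2 ^ t.length) := by
    rw [binVal_append, List.length_append, pow_add]
    push_cast
    field_simp
  have hstep : (0 : ℝ) < 1 / 2 ^ (p ++ t).length := by positivity
  have h1 : (binVal p : ℝ) / 2 ^ p.length ≤ binVal (p ++ t) / 2 ^ (p ++ t).length := by
    rw [hval]
    have : (0 : ℝ) ≤ binVal t / (2 ^ p.length * 2 ^ t.length) := by positivity
    linarith
  have h2 : ((binVal (p ++ t) : ℝ) + 1) / 2 ^ (p ++ t).length ≤ (binVal p + 1) / 2 ^ p.length := by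
    rw [add_div, hval, List.length_append, pow_add, add_div, add_assoc, ← add_div]
    refine add_le_add_right ?_ _
    rw [div_le_div_iff₀ (by positivity) (by positivity)]
    nlinarith [show (0 : ℝ) < 2 ^ p.length by positivity]
  rw [add_div] at h2 hq2
  rw [add_div] at hp2 h2
  rcases lt_trichotomy m n with h | h | h
  · have := mono (Nat.succ_le_of_lt h)
    simp only at this
    linarith
  · exact h
  · have := mono (Nat.succ_le_of_lt h)
    have h3 : (0 : ℝ) < 1 / 2 ^ p.length := by positivity
    simp only at this
    linarith

theorem IsCodeword.eq_of_prefix {l : ℕ → ℕ} {p q : Str} {m n : ℕ} (hp : IsCodeword l p m)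
    (hq : IsCodeword l q n) (hpq : p <+: q) : p = q := by
  obtain rfl := hp.index_eq_of_prefix hq hpq
  exact hpq.eq_of_length (hp.1.trans hq.1.symm)

theorem exists_isCodeword {l : ℕ → ℕ}
    (hsum : ∀ n, ∑ m ∈ Finset.range n, (1 / 2 : ℝ) ^ l m ≤ 1) (n : ℕ) :
    ∃ p, IsCodeword l p n := by
  set F := ∑ m ∈ Finset.range n, (1 / 2 : ℝ) ^ l m with hF
  have hF0 : 0 ≤ F := Finset.sum_nonneg fun _ _ => by positivity
  have hF1 : F + (1 / 2 : ℝ) ^ l n ≤ 1 := by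
    rw [hF, ← Finset.sum_range_succ]; exact hsum _
  have hpow : (1 / 2 : ℝ) ^ l n = 2 / 2 ^ (l n + 1) := by
    rw [one_div, inv_pow, pow_succ]; field_simp
  have hL : (0 : ℝ) < 2 ^ (l n + 1) := by positivity
  -- Rounding up to the grid of step `2^{-(l n + 1)}` loses less than one step, and the `n`-th
  -- interval is two steps long: hence the extra bit.
  set a := ⌈F * 2 ^ (l n + 1)⌉₊ with ha
  have ha1 : F * 2 ^ (l n + 1) ≤ a := Nat.le_ceil _
  have ha2 : (a : ℝ) < F * 2 ^ (l n + 1) + 1 := Nat.ceil_lt_add_one (by positivity)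
  have hub : ((a : ℝ) + 1) / 2 ^ (l n + 1) ≤ F + (1 / 2 : ℝ) ^ l n := by
    rw [hpow, div_le_iff₀ hL, add_mul, div_mul_cancel₀ _ hL.ne']
    linarith
  have hlt : a < 2 ^ (l n + 1) := by
    have := hub.trans hF1
    rw [div_le_one hL] at this
    exact_mod_cast (lt_add_one (a : ℝ)).trans_le this
  obtain ⟨p, hp, hv⟩ := exists_binVal_eq _ a hlt
  refine ⟨p, isCodeword_iff.2 ⟨hp, ?_, ?_⟩⟩
  · rw [hp, hv, le_div_iff₀ hL]; exact ha1
  · rw [hp, hv, Finset.sum_range_succ]; exact hub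

theorem computable_isCodeword {l : ℕ → ℕ} (hl : Computable l) :
    Computable₂ fun p n => decide (IsCodeword l p n) := by
  have pw : Computable₂ ((· ^ ·) : ℕ → ℕ → ℕ) := primrec_nat_pow.to_comp
  have two : Computable fun _ : Str × ℕ => 2 := Computable.const 2
  have mul : Computable₂ ((· * ·) : ℕ → ℕ → ℕ) := Primrec.nat_mul.to_comp
  have le : Computable₂ fun a b : ℕ => decide (a ≤ b) := Primrec.nat_le.decide.to_comp
  have eq : Computable₂ fun a b : ℕ => decide (a = b) := Primrec.eq.decide.to_comp
  have and : Computable₂ Bool.and := Primrec.and.to_comp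
  have len : Computable fun x : Str × ℕ => x.1.length := Computable.list_length.comp Computable.fst
  have val : Computable fun x : Str × ℕ => binVal x.1 :=
    primrec_binVal.to_comp.comp Computable.fst
  have S : Computable fun x : Str × ℕ => dyadicSum l x.2 :=
    (computable_dyadicSum hl).comp Computable.snd
  have S' : Computable fun x : Str × ℕ => dyadicSum l (x.2 + 1) :=
    (computable_dyadicSum hl).comp (Computable.succ.comp Computable.snd)
  have c1 := eq.comp len (Computable.succ.comp (hl.comp Computable.snd))
  have c2 := le.comp (mul.comp (Computable.fst.comp S) (pw.comp two len))
    (mul.comp val (pw.comp two (Computable.snd.comp S)))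
  have c3 := le.comp (mul.comp (Computable.succ.comp val) (pw.comp two (Computable.snd.comp S')))
    (mul.comp (Computable.fst.comp S') (pw.comp two len))
  refine (and.comp c1 (and.comp c2 c3)).of_eq fun x => ?_
  rw [Bool.eq_iff_iff, decide_eq_true_iff]
  simp [IsCodeword]

/-- If `∑ 2 ^ (-l n) ≤ 1` with `l` total recursive, some computer has for every string `s` a
program of length `l (encode s) + 1`. -/
theorem exists_isComputer_length {l : ℕ → ℕ} (hl : Computable l)
    (hsum : ∀ n, ∑ m ∈ Finset.range n, (1 / 2 : ℝ) ^ l m ≤ 1) :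
    ∃ C : Str →. Str, IsComputer C ∧
      ∀ s : Str, ∃ p, s ∈ C p ∧ p.length = l (Encodable.encode s) + 1 := by
  let f : Str → ℕ → Option Str := fun p n =>
    bif decide (IsCodeword l p n) then Encodable.decode n else none
  have hf : Computable₂ f := Computable.cond (computable_isCodeword hl)
    (Computable.decode.comp Computable.snd) (Computable.const none)
  have hmem : ∀ p n s, s ∈ f p n → IsCodeword l p n ∧ Encodable.decode n = some s := by
    intro p n s h
    by_cases hc : IsCodeword l p n
    · exact ⟨hc, by simpa [f, hc] using h⟩
    · simp [f, hc] at h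
  refine ⟨fun p => Nat.rfindOpt (f p), ⟨Partrec.rfindOpt hf, fun p q hp hq hpq => ?_⟩, fun s => ?_⟩
  · obtain ⟨m, s, hm⟩ := Nat.rfindOpt_dom.1 hp
    obtain ⟨n, t, hn⟩ := Nat.rfindOpt_dom.1 hq
    exact (hmem _ _ _ hm).1.eq_of_prefix (hmem _ _ _ hn).1 hpq
  · obtain ⟨p, hp⟩ := exists_isCodeword hsum (Encodable.encode s)
    refine ⟨p, ?_, hp.1⟩
    have hd : (Nat.rfindOpt (f p)).Dom := Nat.rfindOpt_dom.2 ⟨Encodable.encode s, s, by simp [f, hp]⟩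
    obtain ⟨t, ht⟩ := Part.dom_iff_mem.1 hd
    obtain ⟨n, hn⟩ := Nat.rfindOpt_spec ht
    obtain ⟨hc, hdec⟩ := hmem _ _ _ hn
    -- The search may stop at any index with codeword `p`, but there is only one.
    obtain rfl := hp.index_eq_of_prefix hc (List.prefix_refl p)
    rw [Encodable.encodek, Option.some.injEq] at hdec
    exact hdec ▸ ht

/-! ### Traces of positive semi-definite matrices -/

open Matrix in
theorem re_trace_conjTranspose_mul_self {N : ℕ} (A : Matrix (Fin N) (Fin N) ℂ) :
    (Aᴴ * A).trace.re = ∑ i, ∑ j, ‖A i j‖ ^ 2 := by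
  rw [Finset.sum_comm]
  simp only [Matrix.trace, Matrix.diag, Matrix.mul_apply, Matrix.conjTranspose_apply,
    Complex.re_sum]
  refine Finset.sum_congr rfl fun i _ => Finset.sum_congr rfl fun j _ => ?_
  rw [Complex.star_def, ← Complex.normSq_eq_conj_mul_self, Complex.ofReal_re,
    Complex.normSq_eq_norm_sq]

open scoped Matrix.Norms.Frobenius in
theorem sum_sq_mul_le {N : ℕ} (A B : Matrix (Fin N) (Fin N) ℂ) :
    ∑ i, ∑ j, ‖(A * B) i j‖ ^ 2 ≤ (∑ i, ∑ j, ‖A i j‖ ^ 2) * ∑ i, ∑ j, ‖B i j‖ ^ 2 := by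
  have key : ∀ M : Matrix (Fin N) (Fin N) ℂ, ‖M‖ ^ 2 = ∑ i, ∑ j, ‖M i j‖ ^ 2 := by
    intro M
    rw [Matrix.frobenius_norm_def, ← Real.sqrt_eq_rpow, Real.sq_sqrt (by positivity)]
    simp
  rw [← key, ← key, ← key, ← mul_pow]
  exact pow_le_pow_left₀ (norm_nonneg _) (Matrix.frobenius_norm_mul A B) 2

open Matrix in
open scoped ComplexOrder MatrixOrder in
theorem exists_eq_conjTranspose_mul_self {N : ℕ} {A : Matrix (Fin N) (Fin N) ℂ}
    (hA : A.PosSemidef) : ∃ B : Matrix (Fin N) (Fin N) ℂ, A = Bᴴ * B :=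
  CStarAlgebra.nonneg_iff_eq_star_mul_self.1 hA.nonneg

-- With `ρ = BᴴB` and `E = CᴴC`, the trace of `ρE` is the squared Frobenius norm of `BCᴴ`, and that
-- norm is submultiplicative.
open Matrix in
open scoped ComplexOrder in
theorem outcomeProb_nonneg_and_le {N : ℕ} {ρ E : Matrix (Fin N) (Fin N) ℂ}
    (hρ : IsDensityMatrix ρ) (hE : E.PosSemidef) :
    0 ≤ outcomeProb ρ E ∧ outcomeProb ρ E ≤ E.trace.re := by
  obtain ⟨B, hB⟩ := exists_eq_conjTranspose_mul_self hρ.posSemidef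
  obtain ⟨C, hC⟩ := exists_eq_conjTranspose_mul_self hE
  have h1 : outcomeProb ρ E = ∑ i, ∑ j, ‖(B * Cᴴ) i j‖ ^ 2 := by
    rw [outcomeProb, ← re_trace_conjTranspose_mul_self, hB, hC, Matrix.conjTranspose_mul,
      Matrix.conjTranspose_conjTranspose, Matrix.mul_assoc C, Matrix.trace_mul_comm C]
    simp only [Matrix.mul_assoc]
  have hC' : ∑ i, ∑ j, ‖Cᴴ i j‖ ^ 2 = E.trace.re := by
    rw [hC, re_trace_conjTranspose_mul_self, Finset.sum_comm]
    simp
  have hB' : ∑ i, ∑ j, ‖B i j‖ ^ 2 = 1 := by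
    rw [← re_trace_conjTranspose_mul_self, ← hB, hρ.trace_eq_one, Complex.one_re]
  refine ⟨h1 ▸ by positivity, ?_⟩
  have := sum_sq_mul_le B Cᴴ
  rwa [hB', hC', one_mul, ← h1] at this

open scoped Matrix.Norms.L2Operator in
theorem norm_entry_le_l2_opNorm {N : ℕ} (A : Matrix (Fin N) (Fin N) ℂ) (i j : Fin N) :
    ‖A i j‖ ≤ ‖A‖ := by
  have h := A.l2_opNorm_mulVec (EuclideanSpace.single j 1)
  rw [PiLp.norm_single, norm_one, mul_one] at h
  refine le_trans ?_ h
  have := PiLp.norm_apply_le (WithLp.toLp 2 (A.mulVec (EuclideanSpace.single j (1 : ℂ)))) i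
  simpa using this

open scoped ComplexOrder in
theorem IsPOVM.diag_nonneg {N : ℕ} {R : Str → Matrix (Fin N) (Fin N) ℂ} (hR : IsPOVM R)
    (s : Str) (i : Fin N) : 0 ≤ (R s i i).re :=
  (Complex.le_def.1 (hR.posSemidef s).diag_nonneg).1

theorem IsPOVM.hasSum_re_trace {N : ℕ} {R : Str → Matrix (Fin N) (Fin N) ℂ} (hR : IsPOVM R) :
    HasSum (fun s => (R s).trace.re) N := by
  have h := hR.hasSum.map (Matrix.traceAddMonoidHom (Fin N) ℂ)
    (continuous_id.matrix_trace)
  have := Complex.hasSum_re h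
  simpa using this

/-! ### Code lengths from approximate weights -/

theorem computable_finset_sum {α ι : Type} [Primcodable α] (t : Finset ι) {f : ι → α → ℕ}
    (hf : ∀ i, Computable (f i)) : Computable fun a => ∑ i ∈ t, f i a := by
  classical
  induction t using Finset.induction_on with
  | empty => simpa using Computable.const 0
  | insert i t hi ih =>
    simp only [Finset.sum_insert hi]
    exact Primrec.nat_add.to_comp.comp (hf i) ih

/-- The string with number `n` in the standard enumeration. -/
def nthStr (n : ℕ) : Str := (Encodable.decode n).getD []

theorem nthStr_encode (s : Str) : nthStr (Encodable.encode s) = s := by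
  simp [nthStr]

theorem computable_nthStr : Computable nthStr :=
  Computable.option_getD Computable.decode (Computable.const [])

/-- Code lengths for weights `w s * 2 ^ (-encode s)`; numbers that encode no string get a
length of their own. -/
def codeLength (w : Str → ℕ) (c n : ℕ) : ℕ :=
  n + c - bif decide (Encodable.encode (nthStr n) = n) then Nat.log 2 (w (nthStr n)) else 0

theorem computable_codeLength {w : Str → ℕ} (hw : Computable w) (c : ℕ) :
    Computable (codeLength w c) := by
  have sub : Computable₂ ((· - ·) : ℕ → ℕ → ℕ) := Primrec.nat_sub.to_comp
  have add : Computable₂ ((· + ·) : ℕ → ℕ → ℕ) := Primrec.nat_add.to_comp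
  have eq : Computable₂ fun a b : ℕ => decide (a = b) := Primrec.eq.decide.to_comp
  exact sub.comp (add.comp Computable.id (Computable.const c))
    (Computable.cond (eq.comp (Computable.encode.comp computable_nthStr) Computable.id)
      (primrec_nat_log.to_comp.comp (hw.comp computable_nthStr)) (Computable.const 0))

theorem codeLength_encode (w : Str → ℕ) (c : ℕ) (s : Str) :
    codeLength w c (Encodable.encode s) = Encodable.encode s + c - Nat.log 2 (w s) := by
  simp [codeLength, nthStr_encode]

/-- The test discards numbers that encode no string, so `nthStr` is injective on the rest and no
weight is counted twice. -/
theorem sum_range_nthStr_le {r : Str → ℝ} {M : ℝ} (hr0 : ∀ s, 0 ≤ r s) (hr : HasSum r M) (n : ℕ) :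
    ∑ m ∈ Finset.range n, (if Encodable.encode (nthStr m) = m then r (nthStr m) else 0) ≤ M := by
  classical
  rw [← Finset.sum_filter, ← Finset.sum_image (f := r) (g := nthStr)]
  · exact sum_le_hasSum _ (fun s _ => hr0 s) hr
  · intro a ha b hb hab
    simp only [Finset.coe_filter, Set.mem_ofPred_eq] at ha hb
    rw [← ha.2, ← hb.2, hab]

/-- If the integers `w s` approximate `2 ^ encode s * r s` from above with bounded error, for a
nonnegative summable `r`, then there are computable code lengths that satisfy Kraft's inequality
and are at most `-log₂ (r s)` up to a constant. -/
theorem exists_computable_length {r : Str → ℝ} {w : Str → ℕ} {M a : ℕ} (hw : Computable w)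
    (hr0 : ∀ s, 0 ≤ r s) (hr : HasSum r (M : ℝ)) (hpos : ∀ s, 0 < w s)
    (hlow : ∀ s, r s * 2 ^ Encodable.encode s ≤ w s)
    (hup : ∀ s, (w s : ℝ) ≤ r s * 2 ^ Encodable.encode s + a) :
    ∃ (l : ℕ → ℕ) (c : ℕ), Computable l ∧
      (∀ n, ∑ m ∈ Finset.range n, (1 / 2 : ℝ) ^ l m ≤ 1) ∧
      ∀ s, r s ≤ 2 ^ c * (1 / 2 : ℝ) ^ l (Encodable.encode s) := by
  -- The shift must absorb the mass `M` plus a geometric series of sum at most `2(a + 1)`; `c ≤ 2^c`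
  -- suffices. It also keeps the subtraction in `codeLength` from truncating (`hlog`).
  set c := M + 2 * (a + 1) with hc
  have hc2 : (M : ℝ) + 2 * (a + 1) ≤ 2 ^ c := by exact_mod_cast (Nat.lt_two_pow_self (n := c)).le
  have hlog : ∀ s, Nat.log 2 (w s) ≤ Encodable.encode s + c := by
    intro s
    have hrM : r s ≤ M := le_hasSum hr s fun t _ => hr0 t
    have h1 : (1 : ℝ) ≤ 2 ^ Encodable.encode s := one_le_pow₀ one_le_two
    have : (w s : ℝ) ≤ 2 ^ (Encodable.encode s + c) := by
      calc (w s : ℝ) ≤ r s * 2 ^ Encodable.encode s + a := hup s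
        _ ≤ M * 2 ^ Encodable.encode s + a * 2 ^ Encodable.encode s := by
          gcongr
          exact le_mul_of_one_le_right (Nat.cast_nonneg a) h1
        _ = 2 ^ Encodable.encode s * (M + a) := by ring
        _ ≤ 2 ^ Encodable.encode s * 2 ^ c := by
          gcongr
          linarith [(Nat.cast_nonneg a : (0 : ℝ) ≤ a)]
        _ = _ := (pow_add _ _ _).symm
    calc Nat.log 2 (w s) ≤ Nat.log 2 (2 ^ (Encodable.encode s + c)) :=
          Nat.log_mono_right (by exact_mod_cast this)
      _ = _ := Nat.log_pow one_lt_two _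
  have hlen : ∀ s, (1 / 2 : ℝ) ^ codeLength w c (Encodable.encode s) =
      2 ^ Nat.log 2 (w s) / (2 ^ Encodable.encode s * 2 ^ c) := by
    intro s
    rw [codeLength_encode, one_div, inv_pow, ← pow_add, eq_div_iff (by positivity),
      inv_mul_eq_div, div_eq_iff (by positivity), ← pow_add]
    congr 1
    have := hlog s
    omega
  refine ⟨codeLength w c, c + 1, computable_codeLength hw c, fun n => ?_, fun s => ?_⟩
  -- The term `a` pays for the approximation error, and the extra 1 for indices that encode no
  -- string.
  · have hterm : ∀ m, (1 / 2 : ℝ) ^ codeLength w c m ≤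
        ((if Encodable.encode (nthStr m) = m then r (nthStr m) else 0) +
          (a + 1) * (1 / 2 : ℝ) ^ m) / 2 ^ c := by
      intro m
      have hm : (0 : ℝ) < (1 / 2) ^ m := by positivity
      by_cases h : Encodable.encode (nthStr m) = m
      · have h1 := hlen (nthStr m)
        have h2 : ((2 : ℝ) ^ Nat.log 2 (w (nthStr m))) ≤ w (nthStr m) := by
          exact_mod_cast Nat.pow_log_le_self 2 (hpos _).ne'
        have h3 := hup (nthStr m)
        rw [h] at h1 h3
        rw [if_pos h, h1, ← div_div]
        gcongr
        rw [div_le_iff₀ (by positivity), add_mul, mul_assoc, ← mul_pow]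
        norm_num
        linarith
      · rw [if_neg h, codeLength]
        simp only [h, decide_false, cond_false, Nat.sub_zero]
        rw [pow_add, le_div_iff₀ (by positivity), mul_assoc, ← mul_pow]
        norm_num
    calc ∑ m ∈ Finset.range n, (1 / 2 : ℝ) ^ codeLength w c m
        ≤ ∑ m ∈ Finset.range n, ((if Encodable.encode (nthStr m) = m then r (nthStr m) else 0) +
          (a + 1) * (1 / 2 : ℝ) ^ m) / 2 ^ c := Finset.sum_le_sum fun m _ => hterm m
      _ = (∑ m ∈ Finset.range n, (if Encodable.encode (nthStr m) = m then r (nthStr m) else 0) +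
          (a + 1) * ∑ m ∈ Finset.range n, (1 / 2 : ℝ) ^ m) / 2 ^ c := by
        rw [← Finset.sum_div, Finset.sum_add_distrib, Finset.mul_sum]
      _ ≤ (M + (a + 1) * 2) / 2 ^ c := by
        gcongr
        · exact sum_range_nthStr_le hr0 hr n
        · exact sum_geometric_two_le n
      _ ≤ 1 := by
        rw [div_le_one (by positivity)]
        linarith
  -- Rounding `w s` down to a power of two loses a factor below 2, hence the constant `c + 1`.
  · rw [hlen]
    have h1 : (w s : ℝ) ≤ 2 ^ (Nat.log 2 (w s) + 1) := by
      exact_mod_cast (Nat.lt_pow_succ_log_self one_lt_two (w s)).le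
    have h2 := (hlow s).trans h1
    rw [← le_div_iff₀ (by positivity)] at h2
    refine h2.trans_eq ?_
    rw [pow_succ, pow_succ]
    field_simp

/-! ### Weights from a computable POVM -/

theorem num_toNat_mul_div_den_eq_floor (q : ℚ) (m : ℕ) :
    q.num.toNat * m / q.den = ⌊max (q : ℝ) 0 * m⌋₊ := by
  have h : max (q : ℝ) 0 * m = ((q.num.toNat * m : ℕ) : ℝ) / (q.den : ℕ) := by
    have hq : (q : ℝ) = q.num / q.den := by exact_mod_cast (Rat.num_div_den q).symm
    have hnum : ((q.num.toNat : ℕ) : ℝ) = max (q.num : ℝ) 0 := by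
      have : ((q.num.toNat : ℤ)) = max q.num 0 := Int.toNat_eq_max q.num
      exact_mod_cast this
    rw [Nat.cast_mul, hnum, hq, mul_div_right_comm, ← max_div_div_right (Nat.cast_nonneg _)]
    simp
  rw [h, Nat.floor_div_eq_div]

/-- The trace of a computable POVM is approximated from above by a total recursive function. -/
theorem exists_computable_weight {N : ℕ} (hN : 0 < N) {R : Str → Matrix (Fin N) (Fin N) ℂ}
    (hR : IsPOVM R) (hRc : IsComputable R) :
    ∃ w : Str → ℕ, Computable w ∧ (∀ s, 0 < w s) ∧
      (∀ s, (R s).trace.re * 2 ^ Encodable.encode s ≤ w s) ∧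
      ∀ s, (w s : ℝ) ≤ (R s).trace.re * 2 ^ Encodable.encode s + (3 * N : ℕ) := by
  obtain ⟨G, hG, happrox⟩ := hRc
  let q : Fin N → Str → ℚ := fun i s => (G (s, Encodable.encode s) i i).1
  -- After scaling, the approximation error is at most 1 and the floor loses less than 1; adding 2
  -- gives an upper bound with excess at most 3, and a positive weight.
  let b : Fin N → Str → ℕ := fun i s =>
    (q i s).num.toNat * 2 ^ Encodable.encode s / (q i s).den + 2
  have hbc : ∀ i, Computable (b i) := by
    intro i
    have pw : Computable₂ ((· ^ ·) : ℕ → ℕ → ℕ) := primrec_nat_pow.to_comp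
    have mul : Computable₂ ((· * ·) : ℕ → ℕ → ℕ) := Primrec.nat_mul.to_comp
    have div : Computable₂ ((· / ·) : ℕ → ℕ → ℕ) := Primrec.nat_div.to_comp
    have arg : Computable fun s : Str => (s, Encodable.encode s) :=
      Computable.pair Computable.id Computable.encode
    exact Computable.succ.comp <| Computable.succ.comp <|
      div.comp (mul.comp ((hG i i).1.num_pos.comp arg)
        (pw.comp (Computable.const 2) Computable.encode)) ((hG i i).1.den.comp arg)
  have hb : ∀ i s, (R s i i).re * 2 ^ Encodable.encode s ≤ b i s ∧
      (b i s : ℝ) ≤ (R s i i).re * 2 ^ Encodable.encode s + 3 := by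
    intro i s
    set k := Encodable.encode s with hk
    have hpow : (0 : ℝ) < 2 ^ k := by positivity
    have h0 := hR.diag_nonneg s i
    have hd : |(R s i i).re - q i s| * 2 ^ k ≤ 1 := by
      have h1 := (norm_entry_le_l2_opNorm (R s - (G (s, k)).map toComplex) i i).trans_lt
        (happrox s k)
      have h2 : |(R s i i).re - q i s| < 2 ^ (-(k : ℤ)) :=
        (Complex.abs_re_le_norm _).trans_lt h1
      rw [zpow_neg, zpow_natCast, ← one_div, lt_div_iff₀ hpow] at h2
      exact h2.le
    -- Diagonal entries are nonnegative, so truncating the approximation at 0 cannot increase the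
    -- error.
    have hmax : |(R s i i).re - max (q i s : ℝ) 0| ≤ |(R s i i).re - q i s| := by
      have := abs_max_sub_max_le_abs (R s i i).re (q i s : ℝ) 0
      rwa [max_eq_left h0] at this
    have hd' : |((R s i i).re - max (q i s : ℝ) 0) * 2 ^ k| ≤ 1 := by
      rw [abs_mul, abs_of_pos hpow]
      exact (mul_le_mul_of_nonneg_right hmax hpow.le).trans hd
    rw [sub_mul, abs_le] at hd'
    have hfl : (b i s : ℝ) = ⌊max (q i s : ℝ) 0 * (2 ^ k : ℕ)⌋₊ + 2 := by
      rw [← num_toNat_mul_div_den_eq_floor]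
      push_cast [b]
      rfl
    have hx : (0 : ℝ) ≤ max (q i s : ℝ) 0 * (2 ^ k : ℕ) := by positivity
    have hf1 := Nat.floor_le hx
    have hf2 := Nat.lt_floor_add_one (max (q i s : ℝ) 0 * (2 ^ k : ℕ))
    push_cast at hf1 hf2 hfl
    constructor <;> linarith [hd'.1, hd'.2]
  have htr : ∀ s, (R s).trace.re = ∑ i, (R s i i).re := fun s => by
    simp [Matrix.trace]
  refine ⟨fun s => ∑ i, b i s, computable_finset_sum _ hbc, fun s => ?_, fun s => ?_, fun s => ?_⟩
  · exact Finset.sum_pos (fun i _ => by simp [b]) ⟨⟨0, hN⟩, Finset.mem_univ _⟩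
  · rw [htr, Finset.sum_mul]
    push_cast
    exact Finset.sum_le_sum fun i _ => (hb i s).1
  · rw [htr, Finset.sum_mul]
    push_cast
    refine (Finset.sum_le_sum fun i _ => (hb i s).2).trans_eq ?_
    rw [Finset.sum_add_distrib]
    simp [mul_comm]

/-- For an optimal computer, every string has a program of length at most
`-log₂ (tr R(s))` up to a constant. -/
theorem IsOptimal.exists_program {U : Str →. Str} (hU : IsOptimal U) {N : ℕ} (hN : 0 < N)
    {R : Str → Matrix (Fin N) (Fin N) ℂ} (hR : IsPOVM R) (hRc : IsComputable R) :
    ∃ d : ℕ, ∀ s, ∃ p, s ∈ U p ∧ (R s).trace.re ≤ 2 ^ d * (2 : ℝ) ^ (-(p.length : ℤ)) := by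
  obtain ⟨w, hw, hpos, hlow, hup⟩ := exists_computable_weight hN hR hRc
  have hr0 : ∀ s, 0 ≤ (R s).trace.re := fun s => by
    rw [Matrix.trace, Complex.re_sum]
    exact Finset.sum_nonneg fun i _ => hR.diag_nonneg s i
  obtain ⟨l, c, hl, hsum, hc⟩ :=
    exists_computable_length hw hr0 hR.hasSum_re_trace hpos hlow hup
  obtain ⟨C, hC, hprog⟩ := exists_isComputer_length hl hsum
  obtain ⟨sim, hsim⟩ := hU.simulates C hC
  refine ⟨c + 1 + sim, fun s => ?_⟩
  obtain ⟨p, hp, hlen⟩ := hprog s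
  obtain ⟨p', hp', hlen'⟩ := hsim p s hp
  refine ⟨p', hp', (hc s).trans ?_⟩
  rw [hlen] at hlen'
  rw [zpow_neg, zpow_natCast, one_div, inv_pow, ← div_eq_mul_inv, ← div_eq_mul_inv,
    div_le_div_iff₀ (by positivity) (by positivity), ← pow_add, ← pow_add]
  exact pow_le_pow_right₀ one_le_two (by omega)

theorem complexity_le_length {C : Str →. Str} {p s : Str} (hp : s ∈ C p) :
    complexity C s ≤ p.length :=
  iInf_le (fun p : {p : Str // s ∈ C p} => (p.1.length : ℕ∞)) ⟨p, hp⟩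

theorem sub_le_negLogTwo {K : ℕ∞} {n d : ℕ} {x : ℝ} (hK : K ≤ n) (hx0 : 0 ≤ x)
    (hx : x ≤ 2 ^ d * (2 : ℝ) ^ (-(n : ℤ))) :
    ((K : ENNReal) : EReal) - ((d : ℝ) : EReal) ≤ negLogTwo x := by
  rw [negLogTwo]
  split_ifs with h
  · exact le_top
  have hpos : 0 < x := lt_of_le_of_ne hx0 (Ne.symm h)
  have hlog : Real.logb 2 x ≤ d - n := by
    rw [Real.logb_le_iff_le_rpow one_lt_two hpos]
    refine hx.trans_eq ?_
    rw [Real.rpow_sub two_pos, Real.rpow_natCast, Real.rpow_natCast, zpow_neg, zpow_natCast,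
      div_eq_mul_inv]
  obtain ⟨m, rfl⟩ := ENat.ne_top_iff_exists.1 (ne_top_of_le_ne_top (ENat.natCast_ne_top n) hK)
  have hmn : (m : ℝ) ≤ n := by exact_mod_cast hK
  have : (((m : ℕ∞) : ENNReal) : EReal) = ((m : ℝ) : EReal) := by
    rw [ENat.toENNReal_coe, ← ENNReal.ofReal_natCast, EReal.coe_ennreal_ofReal,
      max_eq_left (Nat.cast_nonneg m)]
  rw [this, ← EReal.coe_sub, EReal.coe_le_coe_iff]
  linarith

end AlgPOVM

end

theorem mainTheorem1 (U : AlgPOVM.Str →. AlgPOVM.Str) (hU : AlgPOVM.IsOptimal U)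
    (N : ℕ) (hN : 0 < N) (R : AlgPOVM.Str → Matrix (Fin N) (Fin N) ℂ)
    (hR : AlgPOVM.IsPOVM R) (hRc : AlgPOVM.IsComputable R) :
    (∃ d : ℕ, ∀ ρ : Matrix (Fin N) (Fin N) ℂ, AlgPOVM.IsDensityMatrix ρ → ∀ s : AlgPOVM.Str,
      ((AlgPOVM.complexity U s : ENNReal) : EReal) - ((d : ℝ) : EReal) ≤
        AlgPOVM.negLogTwo (AlgPOVM.outcomeProb ρ (R s))) ∧
    (∃ c : ℝ, 0 < c ∧ ∀ ρ : Matrix (Fin N) (Fin N) ℂ, AlgPOVM.IsDensityMatrix ρ →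
      ∀ s : AlgPOVM.Str,
        AlgPOVM.outcomeProb ρ (R s) ≤ c * AlgPOVM.haltingProb U s) := by
  obtain ⟨d, hd⟩ := hU.exists_program hN hR hRc
  refine ⟨⟨d, fun ρ hρ s => ?_⟩, 2 ^ d, by positivity, fun ρ hρ s => ?_⟩
  · obtain ⟨p, hp, hle⟩ := hd s
    obtain ⟨h0, h1⟩ := AlgPOVM.outcomeProb_nonneg_and_le hρ (hR.posSemidef s)
    exact AlgPOVM.sub_le_negLogTwo (AlgPOVM.complexity_le_length hp) h0 (h1.trans hle)
  · obtain ⟨p, hp, hle⟩ := hd s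
    refine ((AlgPOVM.outcomeProb_nonneg_and_le hρ (hR.posSemidef s)).2.trans hle).trans ?_
    gcongr
    exact hU.isComputer.two_zpow_le_haltingProb hp
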